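/- Let $X_1,X_2,\ldots$ be independent and identically distributed positive random variables whose common distribution has a density, and let $d\ge 0$. Define $$h^{(1)}(x_1,x_2;d)=\frac{|x_1-x_2|}{x_1+x_2}\,\mathbf 1(x_1+x_2>d),\qquad h^{(2)}(x_1,x_2;d)=\mathbf 1(x_1+x_2>d),$$ and for $l=1,2$ and $n\ge 2$ $$U_n^{(l)}(d)=\frac{2}{n(n-1)}\sum_{1\le i<j\le n}h^{(l)}(X_i,X_j;d),\qquad \theta^{(l)}_d=\mathbb E\big[h^{(l)}(X_1,X_2;d)\big],\qquad \mu_d=\theta_d^{(1)},\quad \nu_d=\theta_d^{(2)}.$$ Put $$\psi^{(l)}(x_1,x_2;d)=h^{(l)}(x_1,x_2;d)-\theta^{(l)}_d,\qquad \psi_1^{(l)}(x_1;d)=\mathbb E\big[\psi^{(l)}(x_1,X_2;d)\big],$$ $$\eta_1^{(l)}(d)=\mathbb E\Big[\big(\psi_1^{(l)}(X_1;d)\big)^2\Big]\ (l=1,2),\qquad \eta_1^{(1,2)}(d)=\mathbb E\big[\psi_1^{(1)}(X_1;d)\,\psi_1^{(2)}(X_1;d)\big],$$ $$\Sigma_d=\begin{pmatrix}\eta_1^{(1)}(d)&\eta_1^{(1,2)}(d)\\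 \eta_1^{(1,2)}(d)&\eta_1^{(2)}(d)\end{pmatrix}.$$ If $\eta_1^{(l)}(d)>0$ for $l=1,2$, then $\Sigma_d$ is positive semidefinite and, as $n\to\infty$, $$\sqrt n\left(\begin{pmatrix}U_n^{(1)}(d)\\ U_n^{(2)}(d)\end{pmatrix}-\begin{pmatrix}\mu_d\\ \nu_d\end{pmatrix}\right)\xrightarrow{\ \mathcal D\ }N_2(\mathbf 0,4\Sigma_d).$$ -/

import Mathlib

open MeasureTheory ProbabilityTheory Filter

noncomputable section

namespace GammaTail

/-- The kernel `h⁽¹⁾(x₁, x₂; d) = |x₁ - x₂| / (x₁ + x₂) · 1(x₁ + x₂ > d)`. -/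
def kernel₁ (d x₁ x₂ : ℝ) : ℝ :=
  |x₁ - x₂| / (x₁ + x₂) * (if x₁ + x₂ > d then 1 else 0)

/-- The kernel `h⁽²⁾(x₁, x₂; d) = 1(x₁ + x₂ > d)`. -/
def kernel₂ (d x₁ x₂ : ℝ) : ℝ :=
  if x₁ + x₂ > d then 1 else 0

/-- The U-statistic of degree two `2 / (n (n - 1)) · ∑_{i < j} h(xᵢ, xⱼ)` of the sample
`x 0, …, x (n - 1)`. -/
def uStat (h : ℝ → ℝ → ℝ) (x : ℕ → ℝ) (n : ℕ) : ℝ :=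
  2 / ((n : ℝ) * ((n : ℝ) - 1)) *
    ∑ j ∈ Finset.range n, ∑ i ∈ Finset.range j, h (x i) (x j)

variable {Ω : Type*} [MeasurableSpace Ω]

/-- The mean `θ = E[h(X₁, X₂)]`; the first two variables of the sequence are `X 0` and `X 1`. -/
def theta (P : Measure Ω) (X : ℕ → Ω → ℝ) (h : ℝ → ℝ → ℝ) : ℝ :=
  ∫ ω, h (X 0 ω) (X 1 ω) ∂P

/-- The centred kernel `ψ(x₁, x₂) = h(x₁, x₂) - θ`. -/
def psi (P : Measure Ω) (X : ℕ → Ω → ℝ) (h : ℝ → ℝ → ℝ) (x₁ x₂ : ℝ) : ℝ :=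
  h x₁ x₂ - theta P X h

/-- The first-order projection `ψ₁(x₁) = E[ψ(x₁, X₂)]`. -/
def psiOne (P : Measure Ω) (X : ℕ → Ω → ℝ) (h : ℝ → ℝ → ℝ) (x₁ : ℝ) : ℝ :=
  ∫ ω, psi P X h x₁ (X 1 ω) ∂P

/-- `η₁ = E[ψ₁(X₁)²]`. -/
def eta (P : Measure Ω) (X : ℕ → Ω → ℝ) (h : ℝ → ℝ → ℝ) : ℝ :=
  ∫ ω, (psiOne P X h (X 0 ω)) ^ 2 ∂P

/-- `η₁⁽¹'²⁾ = E[ψ₁⁽¹⁾(X₁) ψ₁⁽²⁾(X₁)]`. -/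
def etaCross (P : Measure Ω) (X : ℕ → Ω → ℝ) (h k : ℝ → ℝ → ℝ) : ℝ :=
  ∫ ω, psiOne P X h (X 0 ω) * psiOne P X k (X 0 ω) ∂P

/-- The covariance matrix `Σ_d` of the first-order projections. -/
def sigmaMatrix (P : Measure Ω) (X : ℕ → Ω → ℝ) (d : ℝ) : Matrix (Fin 2) (Fin 2) ℝ :=
  !![eta P X (kernel₁ d), etaCross P X (kernel₁ d) (kernel₂ d);
     etaCross P X (kernel₁ d) (kernel₂ d), eta P X (kernel₂ d)]

end GammaTail

end

/-!
Hoeffding's decomposition `h(x, y) = θ + ψ₁(x) + ψ₁(y) + r(x, y)` turns `√n (Uₙ - θ)` into the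
normalized sum of the independent vectors `2 ψ₁(Xᵢ)` plus `√n` times the U-statistic of the
degenerate kernel `r`. Since `r` has zero conditional mean given either argument, the terms
`r(Xᵢ, Xⱼ)` with `i < j` are pairwise uncorrelated, so that the last summand has variance `O(1/n)`
and is negligible by Chebyshev's and Slutsky's theorems. The central limit theorem, carried to
vectors by the Cramér–Wold device, gives the Gaussian limit with covariance matrix `4 Σ_d`, and
`Σ_d` is positive semidefinite as a covariance matrix. Positivity of the `Xᵢ` enters through
`|x₁ - x₂| ≤ x₁ + x₂`, which bounds `h⁽¹⁾` by one.
-/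

namespace GammaTail

open WithLp
open scoped Topology RealInnerProductSpace Matrix

section CramerWold

variable {Ω E : Type*} [MeasurableSpace Ω] {P : Measure Ω} [NormedAddCommGroup E]
  [InnerProductSpace ℝ E] [MeasurableSpace E] [BorelSpace E]

lemma charFun_map_inner [SecondCountableTopology E] {Y : Ω → E} (hY : AEMeasurable Y P)
    (t : E) (s : ℝ) :
    charFun (P.map fun ω => ⟪Y ω, t⟫) s = charFun (P.map Y) (s • t) := by
  rw [charFun_apply, charFun_apply, integral_map (by fun_prop) (by fun_prop),
    integral_map hY (by fun_prop)]
  simp only [inner_smul_right, RCLike.inner_apply, conj_trivial]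

theorem tendstoInDistribution_of_inner [FiniteDimensional ℝ E] [IsProbabilityMeasure P]
    {Ω' : Type*} [MeasurableSpace Ω'] {P' : Measure Ω'} [IsProbabilityMeasure P']
    {Y : ℕ → Ω → E} {Z : Ω' → E}
    (hY : ∀ n, AEMeasurable (Y n) P) (hZ : AEMeasurable Z P')
    (h : ∀ t, TendstoInDistribution (fun n ω => ⟪Y n ω, t⟫) atTop (fun ω => ⟪Z ω, t⟫)
      (fun _ => P) P') :
    TendstoInDistribution Y atTop Z (fun _ => P) P' := by
  refine ⟨hY, hZ, ProbabilityMeasure.tendsto_iff_tendsto_charFun.2 fun t => ?_⟩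
  have ht := ProbabilityMeasure.tendsto_iff_tendsto_charFun.1 (h t).tendsto 1
  simpa only [ProbabilityMeasure.coe_mk, charFun_map_inner (hY _), charFun_map_inner hZ,
    one_smul] using ht

end CramerWold

section MultivariateCentralLimit

variable {Ω ι : Type*} [MeasurableSpace Ω] {P : Measure Ω}

/-- The covariance matrix of a random vector, which parametrizes the limit in the multivariate
central limit theorem. -/
noncomputable def covarianceMatrix (P : Measure Ω) (Y : Ω → EuclideanSpace ℝ ι) : Matrix ι ι ℝ :=
  Matrix.of fun i j => cov[fun ω => Y ω i, fun ω => Y ω j; P]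

lemma covarianceMatrix_const_smul (c : ℝ) (Y : Ω → EuclideanSpace ℝ ι) :
    covarianceMatrix P (fun ω => c • Y ω) = c ^ 2 • covarianceMatrix P Y := by
  ext i j
  simp only [covarianceMatrix, PiLp.smul_apply, smul_eq_mul, Matrix.of_apply, Matrix.smul_apply,
    covariance_const_mul_left, covariance_const_mul_right, sq, mul_assoc]

variable [Fintype ι] [IsProbabilityMeasure P] {Y : Ω → EuclideanSpace ℝ ι}

lemma variance_inner (hY : MemLp Y 2 P) (t : EuclideanSpace ℝ ι) :
    Var[fun ω => ⟪Y ω, t⟫; P] = t ⬝ᵥ covarianceMatrix P Y *ᵥ t := by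
  have hcoord (i : ι) : MemLp (fun ω => t i * Y ω i) 2 P :=
    (hY.eval_piLp i).const_mul (t i)
  simp only [PiLp.inner_apply, RCLike.inner_apply, conj_trivial]
  rw [variance_fun_sum hcoord]
  simp only [covariance_const_mul_left, covariance_const_mul_right, dotProduct, Matrix.mulVec,
    covarianceMatrix, Matrix.of_apply, Finset.mul_sum]
  refine Finset.sum_congr rfl fun i _ => Finset.sum_congr rfl fun j _ => ?_
  ring

lemma posSemidef_covarianceMatrix (hY : MemLp Y 2 P) : (covarianceMatrix P Y).PosSemidef := by
  refine Matrix.PosSemidef.of_dotProduct_mulVec_nonneg ?_ fun t => ?_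
  · ext i j
    exact covariance_comm _ _
  · rw [star_trivial, ← ofLp_toLp 2 t, ← variance_inner hY]
    exact variance_nonneg _ _

lemma hasLaw_inner_multivariateGaussian [DecidableEq ι] {S : Matrix ι ι ℝ} (hS : S.PosSemidef)
    (t : EuclideanSpace ℝ ι) :
    HasLaw (fun y => ⟪y, t⟫) (gaussianReal 0 (t ⬝ᵥ S *ᵥ t).toNNReal)
      (multivariateGaussian 0 S) := by
  refine ⟨by fun_prop, Measure.ext_of_charFun (funext fun s => ?_)⟩
  have hnonneg : 0 ≤ t ⬝ᵥ S *ᵥ t := by simpa using hS.dotProduct_mulVec_nonneg (ofLp t)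
  rw [charFun_map_inner (Y := fun y => y) aemeasurable_id', Measure.map_id',
    charFun_multivariateGaussian hS, charFun_gaussianReal, Real.coe_toNNReal _ hnonneg]
  congr 1
  simp [Matrix.mulVec_smul]
  ring

theorem tendstoInDistribution_inv_sqrt_smul_sum_sub [DecidableEq ι]
    {Y : ℕ → Ω → EuclideanSpace ℝ ι} (hY : MemLp (Y 0) 2 P) (hindep : iIndepFun Y P)
    (hident : ∀ k, IdentDistrib (Y k) (Y 0) P P) :
    TendstoInDistribution
      (fun (n : ℕ) ω => (√n)⁻¹ • (∑ k ∈ Finset.range n, Y k ω - (n : ℝ) • P[Y 0])) atTop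
      (id : EuclideanSpace ℝ ι → EuclideanSpace ℝ ι) (fun _ => P)
      (multivariateGaussian 0 (covarianceMatrix P (Y 0))) := by
  have hYm (k : ℕ) : AEMeasurable (Y k) P := (hident k).aemeasurable_fst
  refine tendstoInDistribution_of_inner (fun n => by fun_prop) aemeasurable_id fun t => ?_
  have hinner : Measurable fun y : EuclideanSpace ℝ ι => ⟪y, t⟫ := by fun_prop
  have hlaw := hasLaw_inner_multivariateGaussian (posSemidef_covarianceMatrix hY) t
  rw [← variance_inner hY] at hlaw
  have hmean : P[fun ω => ⟪Y 0 ω, t⟫] = ⟪P[Y 0], t⟫ := by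
    simpa only [real_inner_comm] using integral_inner (hY.integrable one_le_two) t
  have hclt := tendstoInDistribution_inv_sqrt_mul_sum_sub (X := fun k ω => ⟪Y k ω, t⟫) hlaw
    (hY.inner_const t) (hindep.comp (fun _ y => ⟪y, t⟫) fun _ => hinner)
    fun k => (hident k).comp hinner
  simpa only [hmean, real_inner_smul_left, inner_sub_left, sum_inner, id] using hclt

end MultivariateCentralLimit

section ConvergenceInMeasure

variable {Ω : Type*} [MeasurableSpace Ω] {P : Measure Ω} {κ : Type*} {l : Filter κ}

lemma tendstoInMeasure_zero_of_variance [IsFiniteMeasure P] {Z : κ → Ω → ℝ}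
    (hZ : ∀ k, MemLp (Z k) 2 P)
    (hmean : ∀ k, P[Z k] = 0) (hvar : Tendsto (fun k => Var[Z k; P]) l (𝓝 0)) :
    TendstoInMeasure P Z l 0 := by
  rw [tendstoInMeasure_iff_norm]
  intro ε hε
  have hbound : Tendsto (fun k => ENNReal.ofReal (Var[Z k; P] / ε ^ 2)) l (𝓝 0) := by
    simpa using ENNReal.tendsto_ofReal (hvar.div_const (ε ^ 2))
  refine tendsto_of_tendsto_of_tendsto_of_le_of_le tendsto_const_nhds hbound
    (fun _ => bot_le) fun k => ?_
  simpa [hmean] using meas_ge_le_variance_div_sq (hZ k) hε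

lemma tendstoInMeasure_toLp {ι : Type*} [Fintype ι] {Z : κ → Ω → ι → ℝ}
    (hZ : ∀ i, TendstoInMeasure P (fun k ω => Z k ω i) l 0) :
    TendstoInMeasure P (fun k ω => toLp 2 (Z k ω)) l 0 := by
  obtain ⟨C, hC⟩ : ∃ C, LipschitzWith C (toLp 2 : (ι → ℝ) → EuclideanSpace ℝ ι) :=
    ⟨_, PiLp.lipschitzWith_toLp 2 _⟩
  simp only [tendstoInMeasure_iff_norm, Pi.zero_apply, sub_zero] at hZ ⊢
  intro ε hε
  have hsum : Tendsto (fun k => ∑ i, P {ω | ε / (C + 1) ≤ ‖Z k ω i‖}) l (𝓝 0) := by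
    simpa using tendsto_finsetSum Finset.univ fun i _ => hZ i (ε / (C + 1)) (by positivity)
  refine tendsto_of_tendsto_of_tendsto_of_le_of_le tendsto_const_nhds hsum
    (fun _ => bot_le) fun k => (measure_mono fun ω hω => ?_).trans
      (measure_iUnion_fintype_le P fun i => {ω | ε / (C + 1) ≤ ‖Z k ω i‖})
  by_contra hsmall
  simp only [Set.mem_iUnion, Set.mem_ofPred_eq, not_exists, not_le] at hsmall hω
  have hnorm : ‖Z k ω‖ < ε / (C + 1) := (pi_norm_lt_iff (by positivity)).2 hsmall
  rw [lt_div_iff₀ (by positivity)] at hnorm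
  have hdom : ‖toLp 2 (Z k ω)‖ ≤ C * ‖Z k ω‖ := by simpa using hC.dist_le_mul (Z k ω) 0
  nlinarith [norm_nonneg (Z k ω)]

end ConvergenceInMeasure

section Kernels

variable {Ω E I : Type*} [MeasurableSpace Ω] [MeasurableSpace E] {P : Measure Ω} {μ : Measure E}
  {X : I → Ω → E} {h r : E → E → ℝ}

/-- A symmetric measurable kernel `h` that is square integrable on two independent observations
with law `μ`: the kernels of square-integrable U-statistics of degree two. -/
structure IsSquareIntegrableKernel (μ : Measure E) (h : E → E → ℝ) : Prop where
  symm : ∀ x y, h x y = h y x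
  measurable : Measurable (Function.uncurry h)
  memLp : MemLp (Function.uncurry h) 2 (μ.prod μ)

/-- A degenerate kernel: its conditional mean given one of the two observations vanishes. -/
structure IsDegenerateKernel (μ : Measure E) (r : E → E → ℝ) : Prop
    extends IsSquareIntegrableKernel μ r where
  ae_integral_eq_zero : ∀ᵐ y ∂μ, ∫ x, r x y ∂μ = 0

lemma indepFun_of_iIndepFun_triple (hX : ∀ i, AEMeasurable (X i) P) (hindep : iIndepFun X P)
    {i a b c : I} (ha : i ≠ a) (hb : i ≠ b) (hc : i ≠ c) :
    IndepFun (X i) (fun ω => (X a ω, X b ω, X c ω)) P := by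
  classical
  have hdisj : Disjoint ({i} : Finset I) {a, b, c} := by simp [ha, hb, hc]
  exact (hindep.indepFun_finset₀ _ _ hdisj hX).comp
    (φ := fun f : ({i} : Finset I) → E => f ⟨i, by simp⟩)
    (ψ := fun f : ({a, b, c} : Finset I) → E =>
      (f ⟨a, by simp⟩, f ⟨b, by simp⟩, f ⟨c, by simp⟩)) (by fun_prop) (by fun_prop)

lemma hasLaw_pair [IsFiniteMeasure P] (hlaw : ∀ i, HasLaw (X i) μ P) (hindep : iIndepFun X P)
    {i j : I} (hij : i ≠ j) :
    HasLaw (fun ω => (X i ω, X j ω)) (μ.prod μ) P :=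
  IndepFun.hasLaw_prod (hlaw i) (hlaw j) (hindep.indepFun hij)

lemma integral_eq_zero_of_indepFun {F : Type*} [MeasurableSpace F] {ν : Measure F}
    [IsFiniteMeasure P] {Y : Ω → E} {Z : Ω → F} (hY : HasLaw Y μ P) (hZ : HasLaw Z ν P)
    (hind : IndepFun Y Z P) {f : E × F → ℝ} (hf : Integrable f (μ.prod ν))
    (hcond : ∀ᵐ z ∂ν, ∫ y, f (y, z) ∂μ = 0) :
    ∫ ω, f (Y ω, Z ω) ∂P = 0 := by
  have := hY.isFiniteMeasure_iff.1 inferInstance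
  have := hZ.isFiniteMeasure_iff.1 inferInstance
  calc ∫ ω, f (Y ω, Z ω) ∂P
    _ = ∫ p, f p ∂μ.prod ν := (IndepFun.hasLaw_prod hY hZ hind).integral_comp hf.1
    _ = ∫ z, ∫ y, f (y, z) ∂μ ∂ν := integral_prod_symm f hf
    _ = 0 := integral_eq_zero_of_ae hcond

variable [IsProbabilityMeasure P]

lemma IsSquareIntegrableKernel.memLp_pair (hh : IsSquareIntegrableKernel μ h)
    (hlaw : ∀ i, HasLaw (X i) μ P) (hindep : iIndepFun X P) {i j : I} (hij : i ≠ j) :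
    MemLp (fun ω => h (X i ω) (X j ω)) 2 P := by
  have hpair := hasLaw_pair hlaw hindep hij
  have hmem := hh.memLp
  rw [← hpair.map_eq] at hmem
  exact hmem.comp_of_map hpair.aemeasurable

lemma variance_pair (hh : Measurable (Function.uncurry h))
    (hlaw : ∀ i, HasLaw (X i) μ P) (hindep : iIndepFun X P) {i j : I} (hij : i ≠ j) :
    Var[fun ω => h (X i ω) (X j ω); P] = Var[Function.uncurry h; μ.prod μ] := by
  have hpair := hasLaw_pair hlaw hindep hij
  rw [← hpair.map_eq, variance_map hh.aemeasurable hpair.aemeasurable]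
  rfl

lemma IsDegenerateKernel.integral_pair (hr : IsDegenerateKernel μ r)
    (hlaw : ∀ i, HasLaw (X i) μ P) (hindep : iIndepFun X P) {i j : I} (hij : i ≠ j) :
    ∫ ω, r (X i ω) (X j ω) ∂P = 0 := by
  have := (hlaw i).isProbabilityMeasure_iff.1 inferInstance
  exact integral_eq_zero_of_indepFun (hlaw i) (hlaw j) (hindep.indepFun hij)
    (hr.memLp.integrable one_le_two) hr.ae_integral_eq_zero

lemma IsDegenerateKernel.integral_mul_eq_zero (hr : IsDegenerateKernel μ r)
    (hh : IsSquareIntegrableKernel μ h) (hlaw : ∀ i, HasLaw (X i) μ P) (hindep : iIndepFun X P)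
    {i a b c : I} (ha : i ≠ a) (hb : i ≠ b) (hc : i ≠ c) (hbc : b ≠ c) :
    ∫ ω, r (X i ω) (X a ω) * h (X b ω) (X c ω) ∂P = 0 := by
  have hX (k : I) : AEMeasurable (X k) P := (hlaw k).aemeasurable
  set T : Ω → E × E × E := fun ω => (X a ω, X b ω, X c ω)
  have hT : HasLaw T (P.map T) P := ⟨by fun_prop, rfl⟩
  have hind : IndepFun (X i) T P := indepFun_of_iIndepFun_triple hX hindep ha hb hc
  have hjoint := IndepFun.hasLaw_prod (hlaw i) hT hind
  set F : E × E × E × E → ℝ := fun p => r p.1 p.2.1 * h p.2.2.1 p.2.2.2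
  have hF : Measurable F :=
    (hr.measurable.comp (by fun_prop : Measurable fun p : E × E × E × E => (p.1, p.2.1))).mul
      (hh.measurable.comp (by fun_prop : Measurable fun p : E × E × E × E => p.2.2))
  have hFint : Integrable F (μ.prod (P.map T)) := by
    rw [← hjoint.map_eq, integrable_map_measure hF.aestronglyMeasurable hjoint.aemeasurable]
    exact (hr.memLp_pair hlaw hindep ha).integrable_mul (hh.memLp_pair hlaw hindep hbc)
  have hfst : MeasurePreserving Prod.fst (P.map T) μ := ⟨measurable_fst, by
    rw [AEMeasurable.map_map_of_aemeasurable (by fun_prop) hT.aemeasurable]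
    exact (hlaw a).map_eq⟩
  have hcond : ∀ᵐ z ∂P.map T, ∫ x, r x z.1 ∂μ = 0 :=
    hfst.quasiMeasurePreserving.ae hr.ae_integral_eq_zero
  refine integral_eq_zero_of_indepFun (hlaw i) hT hind hFint (hcond.mono fun z hz => ?_)
  simp only [F, integral_mul_const, hz, zero_mul]

lemma IsDegenerateKernel.covariance_pair (hr : IsDegenerateKernel μ r)
    (hlaw : ∀ i, HasLaw (X i) μ P) (hindep : iIndepFun X P)
    {i a b c : I} (ha : i ≠ a) (hb : i ≠ b) (hc : i ≠ c) (hbc : b ≠ c) :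
    cov[fun ω => r (X i ω) (X a ω), fun ω => r (X b ω) (X c ω); P] = 0 := by
  rw [covariance_eq_sub (hr.memLp_pair hlaw hindep ha) (hr.memLp_pair hlaw hindep hbc),
    hr.integral_pair hlaw hindep ha, zero_mul, sub_zero]
  exact hr.integral_mul_eq_zero hr.toIsSquareIntegrableKernel hlaw hindep ha hb hc hbc

end Kernels

section PairSums

lemma sum_pairs_add (f : ℕ → ℝ) (n : ℕ) :
    ∑ j ∈ Finset.range n, ∑ i ∈ Finset.range j, (f i + f j) =
      ((n : ℝ) - 1) * ∑ i ∈ Finset.range n, f i := by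
  induction n with
  | zero => simp
  | succ n ih =>
    rw [Finset.sum_range_succ, ih, Finset.sum_add_distrib, Finset.sum_range_succ]
    simp only [Finset.sum_const, Finset.card_range, nsmul_eq_mul]
    push_cast
    ring

lemma sum_pairs_const (c : ℝ) (n : ℕ) :
    ∑ j ∈ Finset.range n, ∑ _i ∈ Finset.range j, c = n * ((n : ℝ) - 1) / 2 * c := by
  have hsum := sum_pairs_add (fun _ => c / 2) n
  simp only [add_halves] at hsum
  rw [hsum, Finset.sum_const, Finset.card_range, nsmul_eq_mul]
  ring

variable {Ω E : Type*} [MeasurableSpace Ω] [MeasurableSpace E] {P : Measure Ω}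
  [IsProbabilityMeasure P] {μ : Measure E} {X : ℕ → Ω → E} {h r : E → E → ℝ}

lemma IsDegenerateKernel.covariance_of_lt (hr : IsDegenerateKernel μ r)
    (hlaw : ∀ i, HasLaw (X i) μ P) (hindep : iIndepFun X P) {i j a b : ℕ}
    (hij : i < j) (hab : a < b) (hne : (j, i) ≠ (b, a)) :
    cov[fun ω => r (X i ω) (X j ω), fun ω => r (X a ω) (X b ω); P] = 0 := by
  have hne' : j = b → i ≠ a := fun hjb hia => hne (by rw [hjb, hia])
  -- An index belonging to only one of the two pairs is moved to the front.
  rcases lt_trichotomy j b with hjb | rfl | hjb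
  · simp only [hr.symm (X a _)]
    rw [covariance_comm]
    exact hr.covariance_pair hlaw hindep (by omega) (by omega) (by omega) (by omega)
  · exact hr.covariance_pair hlaw hindep (by omega) (by omega) (by omega) (by omega)
  · simp only [hr.symm (X i _)]
    exact hr.covariance_pair hlaw hindep (by omega) (by omega) (by omega) (by omega)

lemma IsDegenerateKernel.variance_sum_pairs (hr : IsDegenerateKernel μ r)
    (hlaw : ∀ i, HasLaw (X i) μ P) (hindep : iIndepFun X P) (n : ℕ) :
    Var[fun ω => ∑ j ∈ Finset.range n, ∑ i ∈ Finset.range j, r (X i ω) (X j ω); P] =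
      n * ((n : ℝ) - 1) / 2 * Var[Function.uncurry r; μ.prod μ] := by
  set s := (Finset.range n).sigma Finset.range with hs
  have hlt : ∀ p ∈ s, p.2 < p.1 := fun p hp => by simpa using (Finset.mem_sigma.1 hp).2
  have hmem : ∀ p ∈ s, MemLp (fun ω => r (X p.2 ω) (X p.1 ω)) 2 P := fun p hp =>
    hr.memLp_pair hlaw hindep (hlt p hp).ne
  calc Var[fun ω => ∑ j ∈ Finset.range n, ∑ i ∈ Finset.range j, r (X i ω) (X j ω); P]
    _ = Var[fun ω => ∑ p ∈ s, r (X p.2 ω) (X p.1 ω); P] := by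
      simp only [hs, Finset.sum_sigma]
    _ = ∑ p ∈ s, Var[fun ω => r (X p.2 ω) (X p.1 ω); P] := by
      rw [variance_fun_sum' hmem]
      refine Finset.sum_congr rfl fun p hp => ?_
      rw [Finset.sum_eq_single_of_mem p hp fun q hq hqp => ?_,
        covariance_self (hmem p hp).aemeasurable]
      refine hr.covariance_of_lt hlaw hindep (hlt p hp) (hlt q hq) fun he => hqp ?_
      exact Sigma.ext (congrArg Prod.fst he).symm (heq_of_eq (congrArg Prod.snd he).symm)
    _ = ∑ _p ∈ s, Var[Function.uncurry r; μ.prod μ] := Finset.sum_congr rfl fun p hp =>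
      variance_pair hr.measurable hlaw hindep (hlt p hp).ne
    _ = n * ((n : ℝ) - 1) / 2 * Var[Function.uncurry r; μ.prod μ] := by
      rw [hs, Finset.sum_sigma, sum_pairs_const]

end PairSums

section DegenerateUStat

variable {Ω : Type*} [MeasurableSpace Ω] {P : Measure Ω} [IsProbabilityMeasure P] {μ : Measure ℝ}
  {X : ℕ → Ω → ℝ} {h r : ℝ → ℝ → ℝ}

lemma IsSquareIntegrableKernel.memLp_uStat (hh : IsSquareIntegrableKernel μ h)
    (hlaw : ∀ i, HasLaw (X i) μ P) (hindep : iIndepFun X P) (n : ℕ) :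
    MemLp (fun ω => uStat h (fun i => X i ω) n) 2 P := by
  have hrow (j : ℕ) : MemLp (fun ω => ∑ i ∈ Finset.range j, h (X i ω) (X j ω)) 2 P :=
    memLp_finsetSum _ fun i hi => hh.memLp_pair hlaw hindep (Finset.mem_range.1 hi).ne
  exact (memLp_finsetSum _ fun j _ => hrow j).const_mul _

lemma IsDegenerateKernel.integral_uStat (hr : IsDegenerateKernel μ r)
    (hlaw : ∀ i, HasLaw (X i) μ P) (hindep : iIndepFun X P) (n : ℕ) :
    ∫ ω, uStat r (fun i => X i ω) n ∂P = 0 := by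
  have hint (j : ℕ) : ∀ i ∈ Finset.range j, Integrable (fun ω => r (X i ω) (X j ω)) P :=
    fun i hi => (hr.memLp_pair hlaw hindep (Finset.mem_range.1 hi).ne).integrable one_le_two
  simp only [uStat]
  rw [integral_const_mul,
    integral_finsetSum _ fun j _ => integrable_finsetSum _ (hint j)]
  refine mul_eq_zero_of_right _ (Finset.sum_eq_zero fun j _ => ?_)
  rw [integral_finsetSum _ (hint j)]
  exact Finset.sum_eq_zero fun i hi => hr.integral_pair hlaw hindep (Finset.mem_range.1 hi).ne

lemma IsDegenerateKernel.variance_uStat (hr : IsDegenerateKernel μ r)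
    (hlaw : ∀ i, HasLaw (X i) μ P) (hindep : iIndepFun X P) (n : ℕ) :
    Var[fun ω => uStat r (fun i => X i ω) n; P] =
      2 / (n * ((n : ℝ) - 1)) * Var[Function.uncurry r; μ.prod μ] := by
  simp only [uStat]
  rw [variance_const_mul, hr.variance_sum_pairs hlaw hindep]
  field_simp

theorem IsDegenerateKernel.tendstoInMeasure_sqrt_mul_uStat (hr : IsDegenerateKernel μ r)
    (hlaw : ∀ i, HasLaw (X i) μ P) (hindep : iIndepFun X P) :
    TendstoInMeasure P (fun (n : ℕ) ω => √n * uStat r (fun i => X i ω) n) atTop 0 := by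
  refine tendstoInMeasure_zero_of_variance
    (fun n => (hr.memLp_uStat hlaw hindep n).const_mul _) (fun n => ?_) ?_
  · rw [integral_const_mul, hr.integral_uStat hlaw hindep, mul_zero]
  have hlim : Tendsto (fun n : ℕ => 2 * Var[Function.uncurry r; μ.prod μ] / ((n : ℝ) - 1))
      atTop (𝓝 0) :=
    tendsto_const_nhds.div_atTop
      (tendsto_atTop_add_const_right atTop (-1 : ℝ) tendsto_natCast_atTop_atTop)
  refine hlim.congr' ?_
  filter_upwards [eventually_gt_atTop 0] with n hn
  rw [variance_const_mul, hr.variance_uStat hlaw hindep, Real.sq_sqrt n.cast_nonneg]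
  field_simp

end DegenerateUStat

section Projection

lemma memLp_two_integral_prod_right {E F : Type*} [MeasurableSpace E] [MeasurableSpace F]
    {μ : Measure E} {ν : Measure F} [SFinite μ] [IsProbabilityMeasure ν] {f : E × F → ℝ}
    (hf : MemLp f 2 (μ.prod ν)) :
    MemLp (fun x => ∫ y, f (x, y) ∂ν) 2 μ := by
  have hmeas : AEStronglyMeasurable (fun x => ∫ y, f (x, y) ∂ν) μ := hf.1.integral_prod_right'
  rw [memLp_two_iff_integrable_sq hmeas]
  refine hf.integrable_sq.integral_prod_left.mono' (hmeas.pow 2) ?_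
  filter_upwards [hf.1.prodMk_left, hf.integrable_sq.prod_right_ae] with x hx hsq
  have hsub := variance_eq_sub ((memLp_two_iff_integrable_sq hx).2 hsq)
  have hnonneg := variance_nonneg (fun y => f (x, y)) ν
  simp only [Pi.pow_apply] at hsub
  rw [Real.norm_of_nonneg (sq_nonneg _)]
  linarith

variable {Ω : Type*} [MeasurableSpace Ω] {P : Measure Ω} {μ : Measure ℝ}
  {X : ℕ → Ω → ℝ} {h : ℝ → ℝ → ℝ}

/-- The second-order term of the Hoeffding decomposition
`h(x, y) = θ + ψ₁(x) + ψ₁(y) + remainder(x, y)`. -/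
noncomputable def remainder (P : Measure Ω) (X : ℕ → Ω → ℝ) (h : ℝ → ℝ → ℝ) (x y : ℝ) : ℝ :=
  psi P X h x y - psiOne P X h x - psiOne P X h y

lemma uStat_sub_theta (x : ℕ → ℝ) {n : ℕ} (hn : 2 ≤ n) :
    uStat h x n - theta P X h =
      2 / n * ∑ i ∈ Finset.range n, psiOne P X h (x i) + uStat (remainder P X h) x n := by
  have hn2 : (2 : ℝ) ≤ n := by exact_mod_cast hn
  have hn1 : (n : ℝ) - 1 ≠ 0 := by linarith
  have hn0 : (n : ℝ) ≠ 0 := by linarith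
  have hsum : ∑ j ∈ Finset.range n, ∑ i ∈ Finset.range j, h (x i) (x j) =
      ∑ j ∈ Finset.range n, ∑ i ∈ Finset.range j, remainder P X h (x i) (x j) +
        ((n : ℝ) - 1) * ∑ i ∈ Finset.range n, psiOne P X h (x i) +
          n * ((n : ℝ) - 1) / 2 * theta P X h := by
    rw [← sum_pairs_add, ← sum_pairs_const]
    simp only [← Finset.sum_add_distrib]
    refine Finset.sum_congr rfl fun j _ => Finset.sum_congr rfl fun i _ => ?_
    rw [remainder, psi]
    ring
  rw [uStat, uStat, hsum]
  field_simp
  ring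

lemma psiOne_eq_integral (hh : Measurable (Function.uncurry h))
    (hlaw : HasLaw (X 1) μ P) (x : ℝ) :
    psiOne P X h x = ∫ y, psi P X h x y ∂μ :=
  hlaw.integral_comp ((hh.of_uncurry_left.sub_const _).aestronglyMeasurable)

lemma measurable_psiOne [IsProbabilityMeasure P] (hh : Measurable (Function.uncurry h))
    (hlaw : HasLaw (X 1) μ P) : Measurable (psiOne P X h) := by
  have := hlaw.isProbabilityMeasure_iff.1 inferInstance
  rw [funext (psiOne_eq_integral hh hlaw)]
  exact (StronglyMeasurable.integral_prod_right
    (hh.sub_const (theta P X h)).stronglyMeasurable).measurable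

lemma IsSquareIntegrableKernel.psi (hh : IsSquareIntegrableKernel μ h) [IsFiniteMeasure μ] :
    IsSquareIntegrableKernel μ (psi P X h) where
  symm x y := by rw [GammaTail.psi, GammaTail.psi, hh.symm]
  measurable := hh.measurable.sub_const _
  memLp := hh.memLp.sub (memLp_const _)

variable [IsProbabilityMeasure P]

lemma memLp_psiOne (hh : IsSquareIntegrableKernel μ h) (hlaw : HasLaw (X 1) μ P) :
    MemLp (psiOne P X h) 2 μ := by
  have := hlaw.isProbabilityMeasure_iff.1 inferInstance
  rw [funext (psiOne_eq_integral hh.measurable hlaw)]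
  exact memLp_two_integral_prod_right (hh.psi (P := P) (X := X)).memLp

lemma integral_psiOne (hh : IsSquareIntegrableKernel μ h) (hlaw : ∀ i, HasLaw (X i) μ P)
    (hindep : iIndepFun X P) : ∫ x, psiOne P X h x ∂μ = 0 := by
  have := (hlaw 0).isProbabilityMeasure_iff.1 inferInstance
  have hpair := hasLaw_pair hlaw hindep zero_ne_one
  have htheta : ∫ p, Function.uncurry h p ∂μ.prod μ = theta P X h :=
    (hpair.integral_comp hh.measurable.aestronglyMeasurable).symm
  calc ∫ x, psiOne P X h x ∂μ
    _ = ∫ x, ∫ y, psi P X h x y ∂μ ∂μ := by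
      simp only [psiOne_eq_integral hh.measurable (hlaw 1)]
    _ = ∫ p, (Function.uncurry h p - theta P X h) ∂μ.prod μ :=
      (integral_prod _ ((hh.psi (P := P) (X := X)).memLp.integrable one_le_two)).symm
    _ = 0 := by
      rw [integral_sub (hh.memLp.integrable one_le_two) (integrable_const _), htheta]
      simp

lemma isDegenerateKernel_remainder (hh : IsSquareIntegrableKernel μ h)
    (hlaw : ∀ i, HasLaw (X i) μ P) (hindep : iIndepFun X P) :
    IsDegenerateKernel μ (remainder P X h) := by
  have := (hlaw 0).isProbabilityMeasure_iff.1 inferInstance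
  have hψ : IsSquareIntegrableKernel μ (psi P X h) := hh.psi
  have hψ₁ := measurable_psiOne hh.measurable (hlaw 1)
  have hψ₁L := memLp_psiOne hh (hlaw 1)
  refine ⟨⟨fun x y => ?_, ?_, ?_⟩, ?_⟩
  · rw [remainder, remainder, hψ.symm x y, sub_right_comm]
  · exact (hψ.measurable.sub (hψ₁.comp measurable_fst)).sub (hψ₁.comp measurable_snd)
  · exact (hψ.memLp.sub (hψ₁L.comp_fst μ)).sub (hψ₁L.comp_snd μ)
  · filter_upwards [(hψ.memLp.integrable one_le_two).prod_left_ae] with y hy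
    have hsection : Integrable (fun x => psi P X h x y) μ := hy
    have hint := hψ₁L.integrable one_le_two
    have hsub : Integrable (fun x => psi P X h x y - psiOne P X h x) μ := hsection.sub hint
    simp only [remainder]
    rw [integral_sub hsub (integrable_const _), integral_sub hsection hint,
      integral_psiOne hh hlaw hindep, psiOne_eq_integral hh.measurable (hlaw 1) y]
    simp [hψ.symm y]

end Projection

section VectorUStat

variable {Ω ι : Type*} [MeasurableSpace Ω] {P : Measure Ω}
  {μ : Measure ℝ} {X : ℕ → Ω → ℝ} {h : ι → ℝ → ℝ → ℝ}

/-- The vector of the first-order projections of a family of kernels. -/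
noncomputable def projectionVector (P : Measure Ω) (X : ℕ → Ω → ℝ) (h : ι → ℝ → ℝ → ℝ) (x : ℝ) :
    EuclideanSpace ℝ ι :=
  toLp 2 fun l => psiOne P X (h l) x

/-- The matrix of the inner products `E[ψ₁⁽ˡ⁾(X₁) ψ₁⁽ᵐ⁾(X₁)]` for a family of kernels; it is
`Σ_d` for the two kernels `h⁽¹⁾, h⁽²⁾`. -/
noncomputable def projectionMatrix (P : Measure Ω) (X : ℕ → Ω → ℝ) (h : ι → ℝ → ℝ → ℝ) :
    Matrix ι ι ℝ :=
  Matrix.of fun l m => etaCross P X (h l) (h m)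

lemma sqrt_smul_uStat_sub_theta (x : ℕ → ℝ) {n : ℕ} (hn : 2 ≤ n) :
    √n • (toLp 2 (fun l => uStat (h l) x n) - toLp 2 fun l => theta P X (h l)) -
      (√n)⁻¹ • ∑ k ∈ Finset.range n, (2 : ℝ) • projectionVector P X h (x k) =
        toLp 2 fun l => √n * uStat (remainder P X (h l)) x n := by
  have hscale : √n * (2 / n) = (√n)⁻¹ * 2 := by
    rw [mul_div_left_comm, Real.sqrt_div_self', one_div, mul_comm]
  ext l
  simp only [PiLp.sub_apply, PiLp.smul_apply, WithLp.ofLp_sum, Finset.sum_apply, smul_eq_mul,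
    uStat_sub_theta x hn, ← Finset.mul_sum, projectionVector, WithLp.ofLp_smul, Pi.smul_apply]
  linear_combination (∑ k ∈ Finset.range n, psiOne P X (h l) (x k)) * hscale

variable [IsProbabilityMeasure P]

lemma integral_projectionVector_apply (hh : ∀ l, IsSquareIntegrableKernel μ (h l))
    (hlaw : ∀ i, HasLaw (X i) μ P) (hindep : iIndepFun X P) (k : ℕ) (l : ι) :
    ∫ ω, projectionVector P X h (X k ω) l ∂P = 0 :=
  ((hlaw k).integral_comp
    (measurable_psiOne (hh l).measurable (hlaw 1)).aestronglyMeasurable).trans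
      (integral_psiOne (hh l) hlaw hindep)

lemma memLp_projectionVector [Fintype ι] (hh : ∀ l, IsSquareIntegrableKernel μ (h l))
    (hlaw : ∀ i, HasLaw (X i) μ P) (k : ℕ) :
    MemLp (fun ω => projectionVector P X h (X k ω)) 2 P := by
  refine MemLp.of_eval_piLp fun l => ?_
  have hψ₁ := memLp_psiOne (hh l) (hlaw 1)
  rw [← (hlaw k).map_eq] at hψ₁
  exact hψ₁.comp_of_map (hlaw k).aemeasurable

lemma covarianceMatrix_projectionVector [Finite ι] (hh : ∀ l, IsSquareIntegrableKernel μ (h l))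
    (hlaw : ∀ i, HasLaw (X i) μ P) (hindep : iIndepFun X P) :
    covarianceMatrix P (fun ω => projectionVector P X h (X 0 ω)) = projectionMatrix P X h := by
  cases nonempty_fintype ι
  have hL := memLp_projectionVector hh hlaw 0
  ext l m
  rw [covarianceMatrix, Matrix.of_apply, covariance_eq_sub (hL.eval_piLp l) (hL.eval_piLp m),
    integral_projectionVector_apply hh hlaw hindep, zero_mul, sub_zero]
  rfl

lemma posSemidef_projectionMatrix [Finite ι] (hh : ∀ l, IsSquareIntegrableKernel μ (h l))
    (hlaw : ∀ i, HasLaw (X i) μ P) (hindep : iIndepFun X P) :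
    (projectionMatrix P X h).PosSemidef := by
  cases nonempty_fintype ι
  rw [← covarianceMatrix_projectionVector hh hlaw hindep]
  exact posSemidef_covarianceMatrix (memLp_projectionVector hh hlaw 0)

variable [Fintype ι] [DecidableEq ι]

lemma tendstoInDistribution_sum_projectionVector (hh : ∀ l, IsSquareIntegrableKernel μ (h l))
    (hlaw : ∀ i, HasLaw (X i) μ P) (hindep : iIndepFun X P) :
    TendstoInDistribution
      (fun (n : ℕ) ω => (√n)⁻¹ • ∑ k ∈ Finset.range n, (2 : ℝ) • projectionVector P X h (X k ω))
      atTop (id : EuclideanSpace ℝ ι → EuclideanSpace ℝ ι) (fun _ => P)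
      (multivariateGaussian 0 ((4 : ℝ) • projectionMatrix P X h)) := by
  have hmeas : Measurable fun x => (2 : ℝ) • projectionVector P X h x := by
    have hψ₁ (l : ι) := measurable_psiOne (hh l).measurable (hlaw 1)
    unfold projectionVector
    fun_prop
  have hident (k : ℕ) : IdentDistrib (X k) (X 0) P P :=
    ⟨(hlaw k).aemeasurable, (hlaw 0).aemeasurable, (hlaw k).map_eq.trans (hlaw 0).map_eq.symm⟩
  have hL := memLp_projectionVector hh hlaw 0
  have hmean : ∫ ω, (2 : ℝ) • projectionVector P X h (X 0 ω) ∂P = 0 := by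
    ext l
    rw [integral_smul, PiLp.smul_apply,
      eval_integral_piLp (fun l => (hL.eval_piLp l).integrable one_le_two),
      integral_projectionVector_apply hh hlaw hindep, smul_zero, PiLp.zero_apply]
  have hclt := tendstoInDistribution_inv_sqrt_smul_sum_sub
    (Y := fun k ω => (2 : ℝ) • projectionVector P X h (X k ω)) (hL.const_smul (2 : ℝ))
    (hindep.comp (fun _ x => (2 : ℝ) • projectionVector P X h x) fun _ => hmeas)
    fun k => (hident k).comp hmeas
  have hcov : covarianceMatrix P (fun ω => (2 : ℝ) • projectionVector P X h (X 0 ω)) =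
      (4 : ℝ) • projectionMatrix P X h := by
    rw [covarianceMatrix_const_smul, covarianceMatrix_projectionVector hh hlaw hindep]
    norm_num
  simpa only [hmean, smul_zero, sub_zero, hcov] using hclt

theorem tendstoInDistribution_uStat (hh : ∀ l, IsSquareIntegrableKernel μ (h l))
    (hlaw : ∀ i, HasLaw (X i) μ P) (hindep : iIndepFun X P) :
    TendstoInDistribution
      (fun (n : ℕ) ω => √n • (toLp 2 (fun l => uStat (h l) (fun i => X i ω) n) -
        toLp 2 fun l => theta P X (h l))) atTop
      (id : EuclideanSpace ℝ ι → EuclideanSpace ℝ ι) (fun _ => P)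
      (multivariateGaussian 0 ((4 : ℝ) • projectionMatrix P X h)) := by
  refine tendstoInDistribution_of_tendstoInMeasure_sub _ _
    (tendstoInDistribution_sum_projectionVector hh hlaw hindep) ?_ fun n => ?_
  · have hrem := tendstoInMeasure_toLp fun l =>
      (isDegenerateKernel_remainder (hh l) hlaw hindep).tendstoInMeasure_sqrt_mul_uStat hlaw hindep
    refine hrem.congr' ?_ (ae_eq_refl _)
    filter_upwards [eventually_ge_atTop 2] with n hn
    exact ae_of_all _ fun ω => (sqrt_smul_uStat_sub_theta _ hn).symm
  · have hU (l : ι) : AEMeasurable (fun ω => uStat (h l) (fun i => X i ω) n) P :=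
      ((hh l).memLp_uStat hlaw hindep n).aemeasurable
    fun_prop

end VectorUStat

section GammaKernels

variable {d : ℝ}

lemma kernel₁_symm (x y : ℝ) : kernel₁ d x y = kernel₁ d y x := by
  simp only [kernel₁, abs_sub_comm x y, add_comm x y]

lemma kernel₂_symm (x y : ℝ) : kernel₂ d x y = kernel₂ d y x := by
  simp only [kernel₂, add_comm x y]

lemma measurable_kernel₂ : Measurable (Function.uncurry (kernel₂ d)) :=
  Measurable.ite (measurableSet_lt measurable_const (measurable_fst.add measurable_snd))
    measurable_const measurable_const

lemma measurable_kernel₁ : Measurable (Function.uncurry (kernel₁ d)) := by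
  have hquot : Measurable fun p : ℝ × ℝ => |p.1 - p.2| / (p.1 + p.2) := by fun_prop
  exact hquot.mul measurable_kernel₂

lemma abs_kernel₂_le_one (x y : ℝ) : |kernel₂ d x y| ≤ 1 := by
  unfold kernel₂
  split_ifs <;> simp

lemma abs_kernel₁_le_one {x y : ℝ} (hx : 0 ≤ x) (hy : 0 ≤ y) : |kernel₁ d x y| ≤ 1 := by
  have hquot : |x - y| / (x + y) ≤ 1 :=
    div_le_one_of_le₀ (abs_le.2 ⟨by linarith, by linarith⟩) (by linarith)
  rw [kernel₁, abs_mul, abs_of_nonneg (by positivity : 0 ≤ |x - y| / (x + y))]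
  exact mul_le_one₀ hquot (abs_nonneg _) (abs_kernel₂_le_one x y)

variable {μ : Measure ℝ} [IsFiniteMeasure μ]

lemma isSquareIntegrableKernel_kernel₁ (hμ : ∀ᵐ x ∂μ, 0 ≤ x) :
    IsSquareIntegrableKernel μ (kernel₁ d) where
  symm := kernel₁_symm
  measurable := measurable_kernel₁
  memLp := by
    refine MemLp.of_bound measurable_kernel₁.aestronglyMeasurable 1 ?_
    filter_upwards [Measure.quasiMeasurePreserving_fst.ae hμ,
      Measure.quasiMeasurePreserving_snd.ae hμ] with p hp₁ hp₂
    exact abs_kernel₁_le_one hp₁ hp₂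

lemma isSquareIntegrableKernel_kernel₂ : IsSquareIntegrableKernel μ (kernel₂ d) where
  symm := kernel₂_symm
  measurable := measurable_kernel₂
  memLp := MemLp.of_bound measurable_kernel₂.aestronglyMeasurable 1
    (ae_of_all _ fun p => abs_kernel₂_le_one p.1 p.2)

lemma projectionMatrix_kernels {Ω : Type*} [MeasurableSpace Ω] (P : Measure Ω)
    (X : ℕ → Ω → ℝ) (d : ℝ) :
    projectionMatrix P X ![kernel₁ d, kernel₂ d] = sigmaMatrix P X d := by
  ext l m
  fin_cases l <;> fin_cases m <;>
    simp [projectionMatrix, sigmaMatrix, eta, etaCross, sq, mul_comm]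

end GammaKernels

end GammaTail

theorem proposition4_general {Ω : Type*} [MeasurableSpace Ω] {P : Measure Ω}
    [IsProbabilityMeasure P] {X : ℕ → Ω → ℝ}
    (hindep : iIndepFun X P) (hident : ∀ i, IdentDistrib (X i) (X 0) P P)
    (hpos : ∀ᵐ ω ∂P, 0 < X 0 ω) (d : ℝ) :
    (GammaTail.sigmaMatrix P X d).PosSemidef ∧
    TendstoInDistribution
      (fun (n : ℕ) (ω : Ω) =>
        Real.sqrt n •
          (!₂[GammaTail.uStat (GammaTail.kernel₁ d) (fun i => X i ω) n,
              GammaTail.uStat (GammaTail.kernel₂ d) (fun i => X i ω) n] -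
           !₂[GammaTail.theta P X (GammaTail.kernel₁ d),
              GammaTail.theta P X (GammaTail.kernel₂ d)]))
      atTop
      (id : EuclideanSpace ℝ (Fin 2) → EuclideanSpace ℝ (Fin 2))
      (fun _ => P)
      (multivariateGaussian 0 ((4 : ℝ) • GammaTail.sigmaMatrix P X d)) := by
  open GammaTail in
  have hlaw (i : ℕ) : HasLaw (X i) (P.map (X 0)) P :=
    ⟨(hident i).aemeasurable_fst, (hident i).map_eq⟩
  have hnonneg : ∀ᵐ x ∂P.map (X 0), 0 ≤ x :=
    ((hlaw 0).ae_iff (by fun_prop)).1 (hpos.mono fun ω => le_of_lt)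
  have hkernels (l : Fin 2) :
      IsSquareIntegrableKernel (P.map (X 0)) (![kernel₁ d, kernel₂ d] l) := by
    fin_cases l
    · exact isSquareIntegrableKernel_kernel₁ hnonneg
    · exact isSquareIntegrableKernel_kernel₂
  have hpair (f : (ℝ → ℝ → ℝ) → ℝ) :
      WithLp.toLp 2 (fun l => f (![kernel₁ d, kernel₂ d] l)) =
        !₂[f (kernel₁ d), f (kernel₂ d)] := by
    ext l
    fin_cases l <;> rfl
  have hclt := tendstoInDistribution_uStat hkernels hlaw hindep
  have hpairU (x : ℕ → ℝ) (n : ℕ) := hpair fun h => uStat h x n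
  simp only [hpair, hpairU, projectionMatrix_kernels] at hclt
  refine ⟨?_, hclt⟩
  rw [← projectionMatrix_kernels]
  exact posSemidef_projectionMatrix hkernels hlaw hindep

theorem proposition4 {Ω : Type*} [MeasurableSpace Ω] (P : Measure Ω) [IsProbabilityMeasure P]
    (X : ℕ → Ω → ℝ) (hmeas : ∀ i, Measurable (X i))
    (hindep : iIndepFun X P) (hident : ∀ i, IdentDistrib (X i) (X 0) P P)
    (hpos : ∀ i, ∀ᵐ ω ∂P, 0 < X i ω) (hpdf : HasPDF (X 0) P volume)
    (d : ℝ) (hd : 0 ≤ d)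
    (hη₁ : 0 < GammaTail.eta P X (GammaTail.kernel₁ d))
    (hη₂ : 0 < GammaTail.eta P X (GammaTail.kernel₂ d)) :
    (GammaTail.sigmaMatrix P X d).PosSemidef ∧
    TendstoInDistribution
      (fun (n : ℕ) (ω : Ω) =>
        Real.sqrt n •
          (!₂[GammaTail.uStat (GammaTail.kernel₁ d) (fun i => X i ω) n,
              GammaTail.uStat (GammaTail.kernel₂ d) (fun i => X i ω) n] -
           !₂[GammaTail.theta P X (GammaTail.kernel₁ d),
              GammaTail.theta P X (GammaTail.kernel₂ d)]))
      atTop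
      (id : EuclideanSpace ℝ (Fin 2) → EuclideanSpace ℝ (Fin 2))
      (fun _ => P)
      (multivariateGaussian 0 ((4 : ℝ) • GammaTail.sigmaMatrix P X d)) :=
  proposition4_general hindep hident (hpos 0) d
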